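/- Let $\mathbb{K}$ be $\mathbb{R}$ or $\mathbb{C}$ and let $m\ge 2$ be an integer. For a positive integer $n$, let $\ell_m^n$ be $\mathbb{K}^n$ with the norm $\|x\|_m=(\sum_{i=1}^n|x_i|^m)^{1/m}$. For a multi-index $\alpha=(\alpha_1,\dots,\alpha_n)$ of non-negative integers write $|\alpha|=\alpha_1+\cdots+\alpha_n$ and $x^\alpha=x_1^{\alpha_1}\cdots x_n^{\alpha_n}$. For an $m$-homogeneous polynomial $P(x)=\sum_{|\alpha|=m}a_\alpha x^\alpha$ with coefficients $a_\alpha\in\mathbb{K}$ put $\|P\|=\sup\{|P(x)| : x\in\mathbb{K}^n,\ \|x\|_m\le 1\}$. **Theorem (Hardy--Littlewood inequality for $m$-homogeneous polynomials on $\ell_m$).** There is an optimal (that is, smallest) real constant $C_{\mathbb{K},m}$, depending only on $\mathbb{K}$ and $m$, such that $$\max_{|\alpha|=m}|a_\alpha|\le C_{\mathbb{K},m}\,\|P\|$$ for all positive integers $n$ and all $m$-homogeneous polynomials $P=\sum_{|\alpha|=m}a_\alpha x^\alpha$ on $\ell_m^n$ over $\mathbb{K}$. It satisfies $C_{\mathbb{K},m}\ge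 1$ and $$C_{\mathbb{R},m}\le(\sqrt2)^{m-1}m^m,\qquad C_{\mathbb{C},m}\le\Big(\frac{2}{\sqrt\pi}\Big)^{m-1}m^m.$$ Moreover, the $\sup$ norm on the left-hand side cannot be replaced by any $\ell_r$-norm with $r<\infty$: for $\mathbb{K}=\mathbb{R}$ and for $\mathbb{K}=\mathbb{C}$, and for every real $r>0$, there is no constant $C$ such that $$\Big(\sum_{|\alpha|=m}|a_\alpha|^r\Big)^{1/r}\le C\,\|P\|$$ for all positive integers $n$ and all $m$-homogeneous polynomials $P=\sum_{|\alpha|=m}a_\alpha x^\alpha$ on $\ell_m^n$ over $\mathbb{K}$. -/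

import Mathlib

open scoped NNReal ENNReal

namespace HardyLittlewood

noncomputable section

/-- The finite set of multi-indices `α ∈ ℕⁿ` with `|α| = α₁ + ⋯ + αₙ = m`. -/
def multiIndices (n m : ℕ) : Finset (Fin n →₀ ℕ) :=
  Finset.finsuppAntidiag Finset.univ m

theorem mem_multiIndices {n m : ℕ} {α : Fin n →₀ ℕ} :
    α ∈ multiIndices n m ↔ ∑ i, α i = m := by
  simp [multiIndices, Finset.mem_finsuppAntidiag]

/-- The norm of a polynomial `P` on `ℓ_p^n`, that is, the supremum of `|P(x)|` over the closed
unit ball of `ℓ_p^n`. -/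
def polyNorm {𝕜 : Type*} [RCLike 𝕜] {n : ℕ} (p : ℝ≥0∞) (P : MvPolynomial (Fin n) 𝕜) : ℝ :=
  ⨆ x : {x : PiLp p (fun _ : Fin n => 𝕜) // ‖x‖ ≤ 1}, ‖MvPolynomial.eval (fun i => x.1 i) P‖

/-- The quantity `max_{|α| = m} |a_α|` for `P = ∑ a_α x^α`. -/
def coeffMax {𝕜 : Type*} [RCLike 𝕜] {n : ℕ} (m : ℕ) (P : MvPolynomial (Fin n) 𝕜) : ℝ :=
  ((multiIndices n m).sup (fun α => ‖P.coeff α‖₊) : ℝ≥0)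

/-- The quantity `(∑_{|α| = m} |a_α|^r)^{1/r}` for `P = ∑ a_α x^α`. -/
def coeffLr {𝕜 : Type*} [RCLike 𝕜] {n : ℕ} (m : ℕ) (r : ℝ) (P : MvPolynomial (Fin n) 𝕜) : ℝ :=
  (∑ α ∈ multiIndices n m, ‖P.coeff α‖ ^ r) ^ (1 / r)

/-- The constants `C` such that `max_{|α| = m} |a_α| ≤ C ‖P‖` for all positive integers `n` and all
`m`-homogeneous polynomials `P = ∑_{|α| = m} a_α x^α` on `ℓ_m^n` over `𝕜`. -/
def supConstants (𝕜 : Type*) [RCLike 𝕜] (m : ℕ) : Set ℝ :=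
  {C | ∀ n : ℕ, 1 ≤ n → ∀ P : MvPolynomial (Fin n) 𝕜, P.IsHomogeneous m →
    coeffMax m P ≤ C * polyNorm (m : ℝ≥0∞) P}

/-- The constants `C` such that `(∑_{|α| = m} |a_α|^r)^{1/r} ≤ C ‖P‖` for all positive integers `n`
and all `m`-homogeneous polynomials `P = ∑_{|α| = m} a_α x^α` on `ℓ_m^n` over `𝕜`. -/
def lrConstants (𝕜 : Type*) [RCLike 𝕜] (m : ℕ) (r : ℝ) : Set ℝ :=
  {C | ∀ n : ℕ, 1 ≤ n → ∀ P : MvPolynomial (Fin n) 𝕜, P.IsHomogeneous m →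
    coeffLr m r P ≤ C * polyNorm (m : ℝ≥0∞) P}

end

end HardyLittlewood

namespace HardyLittlewood

/-! ### The supremum over the unit ball and its scaling. -/

section Norm

variable {𝕜 : Type*} [RCLike 𝕜] {n m : ℕ}

/-! Applying the mixed finite difference of order `α` to `P` isolates `α! a_α`
(`sum_choose_mul_eval_eq`). If the nodes are centred at the origin, they lie in the ball of radius
`m/2` of `ℓ_m^n`, and the binomial weights have total mass `2^m`. Hence `|a_α| ≤ 2^m (m/2)^m ‖P‖ =
m^m ‖P‖` (`norm_coeff_le`), which is sharper than both stated bounds. The power sum `∑ x_i^m` has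
norm at most 1 and `n` coefficients equal to 1. This gives `C ≥ 1` and rules out every finite `r`.
-/

theorem norm_le_one_iff_sum_pow_le_one (hm : 1 ≤ m) (x : PiLp (m : ℝ≥0∞) (fun _ : Fin n => 𝕜)) :
    ‖x‖ ≤ 1 ↔ ∑ i, ‖x i‖ ^ m ≤ 1 := by
  have hm0 : (0 : ℝ) < m := by exact_mod_cast hm
  rw [PiLp.norm_eq_sum (by simpa using hm0)]
  simp only [ENNReal.toReal_natCast, Real.rpow_natCast]
  have h0 : 0 ≤ ∑ i, ‖x i‖ ^ m := Finset.sum_nonneg fun i _ => by positivity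
  simpa using Real.rpow_le_rpow_iff h0 zero_le_one (one_div_pos.2 hm0)

theorem norm_apply_le_one {y : Fin n → 𝕜} (hm : 1 ≤ m) (hy : ∑ i, ‖y i‖ ^ m ≤ 1) (i : Fin n) :
    ‖y i‖ ≤ 1 := by
  have h : ‖y i‖ ^ m ≤ 1 :=
    (Finset.single_le_sum (f := fun i => ‖y i‖ ^ m) (fun j _ => by positivity)
      (Finset.mem_univ i)).trans hy
  exact (pow_le_one_iff_of_nonneg (norm_nonneg _) (by omega)).1 h

/-- Needed because a real `⨆` over an unbounded family takes the junk value 0. -/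
theorem bddAbove_norm_eval (hm : 1 ≤ m) (P : MvPolynomial (Fin n) 𝕜) :
    BddAbove (Set.range fun x : {x : PiLp (m : ℝ≥0∞) (fun _ : Fin n => 𝕜) // ‖x‖ ≤ 1} =>
      ‖MvPolynomial.eval (fun i => x.1 i) P‖) := by
  refine ⟨∑ d ∈ P.support, ‖P.coeff d‖, ?_⟩
  rintro _ ⟨⟨x, hx⟩, rfl⟩
  rw [norm_le_one_iff_sum_pow_le_one hm] at hx
  simp only [MvPolynomial.eval_eq']
  refine (norm_sum_le _ _).trans (Finset.sum_le_sum fun d _ => ?_)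
  rw [norm_mul, norm_prod]
  refine mul_le_of_le_one_right (norm_nonneg _) (Finset.prod_le_one (fun i _ => norm_nonneg _) ?_)
  intro i _
  rw [norm_pow]
  exact pow_le_one₀ (norm_nonneg _) (norm_apply_le_one hm hx i)

theorem norm_eval_le_polyNorm (hm : 1 ≤ m) (P : MvPolynomial (Fin n) 𝕜) (y : Fin n → 𝕜)
    (hy : ∑ i, ‖y i‖ ^ m ≤ 1) : ‖MvPolynomial.eval y P‖ ≤ polyNorm (m : ℝ≥0∞) P :=
  le_ciSup (bddAbove_norm_eval hm P)
    ⟨WithLp.toLp _ y, (norm_le_one_iff_sum_pow_le_one hm _).2 hy⟩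

theorem polyNorm_nonneg (p : ℝ≥0∞) (P : MvPolynomial (Fin n) 𝕜) : 0 ≤ polyNorm p P :=
  Real.iSup_nonneg fun _ => norm_nonneg _

theorem polyNorm_le (hm : 1 ≤ m) (P : MvPolynomial (Fin n) 𝕜) {B : ℝ}
    (h : ∀ y : Fin n → 𝕜, ∑ i, ‖y i‖ ^ m ≤ 1 → ‖MvPolynomial.eval y P‖ ≤ B) :
    polyNorm (m : ℝ≥0∞) P ≤ B := by
  have : Nonempty {x : PiLp (m : ℝ≥0∞) (fun _ : Fin n => 𝕜) // ‖x‖ ≤ 1} :=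
    ⟨⟨0, (norm_le_one_iff_sum_pow_le_one hm _).2 (by simp [zero_pow (by omega : m ≠ 0)])⟩⟩
  exact ciSup_le fun x => h _ ((norm_le_one_iff_sum_pow_le_one hm _).1 x.2)

theorem sum_eq_of_coeff_ne_zero {P : MvPolynomial (Fin n) 𝕜} (hP : P.IsHomogeneous m)
    {d : Fin n →₀ ℕ} (hd : P.coeff d ≠ 0) : ∑ i, d i = m := by
  rw [← hP hd, Finsupp.weight_apply, Finsupp.sum_fintype _ _ (by simp)]
  simp

theorem eval_mul_of_isHomogeneous {P : MvPolynomial (Fin n) 𝕜} (hP : P.IsHomogeneous m)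
    (c : 𝕜) (y : Fin n → 𝕜) :
    MvPolynomial.eval (fun i => c * y i) P = c ^ m * MvPolynomial.eval y P := by
  simp only [MvPolynomial.eval_eq', Finset.mul_sum, mul_pow, Finset.prod_mul_distrib]
  refine Finset.sum_congr rfl fun d hd => ?_
  rw [Finset.prod_pow_eq_pow_sum, sum_eq_of_coeff_ne_zero hP (MvPolynomial.mem_support_iff.1 hd)]
  ring

theorem norm_eval_le_mul_polyNorm (hm : 1 ≤ m) {P : MvPolynomial (Fin n) 𝕜}
    (hP : P.IsHomogeneous m) {R : ℝ} (hR : 0 < R) (y : Fin n → 𝕜)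
    (hy : ∑ i, ‖y i‖ ^ m ≤ R ^ m) :
    ‖MvPolynomial.eval y P‖ ≤ R ^ m * polyNorm (m : ℝ≥0∞) P := by
  have hR0 : (R : 𝕜) ≠ 0 := by exact_mod_cast hR.ne'
  have hnorm : ‖(R : 𝕜)‖ = R := by rw [RCLike.norm_ofReal, abs_of_pos hR]
  have hy' : y = fun i => (R : 𝕜) * ((R : 𝕜)⁻¹ * y i) := by
    funext i
    rw [mul_inv_cancel_left₀ hR0]
  rw [hy', eval_mul_of_isHomogeneous hP, norm_mul, norm_pow, hnorm]
  refine mul_le_mul_of_nonneg_left (norm_eval_le_polyNorm hm P _ ?_) (by positivity)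
  simp only [norm_mul, norm_inv, hnorm, mul_pow, ← Finset.mul_sum, inv_pow]
  exact inv_mul_le_one_of_le₀ hy (by positivity)

end Norm

/-! ### Coefficients from finite differences. -/

section Coefficients

variable {𝕜 : Type*} [RCLike 𝕜] {n m : ℕ}

theorem sum_choose_mul_pow_self (a : ℕ) (y : 𝕜) :
    ∑ k ∈ Finset.range (a + 1), ((-1 : 𝕜) ^ (a - k) * a.choose k) * (y + k) ^ a
      = a.factorial := by
  have h := congrFun (fwdDiff_iter_eq_factorial (R := 𝕜) (n := a)) y
  rw [fwdDiff_iter_eq_sum_shift] at h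
  simpa using h

theorem sum_choose_mul_pow_of_lt {a b : ℕ} (hb : b < a) (y : 𝕜) :
    ∑ k ∈ Finset.range (a + 1), ((-1 : 𝕜) ^ (a - k) * a.choose k) * (y + k) ^ b = 0 := by
  have h := congrFun (fwdDiff_iter_pow_eq_zero_of_lt (R := 𝕜) hb) y
  rw [fwdDiff_iter_eq_sum_shift] at h
  simpa using h

/-- On each monomial the difference factors over the coordinates. A multi-index `d ≠ α` of the same
degree has some `d i < α i`, and the difference of order `α i` kills that factor; for `d = α` each
factor is `(α i)!`. -/
theorem sum_choose_mul_eval_eq {P : MvPolynomial (Fin n) 𝕜} (hP : P.IsHomogeneous m)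
    {α : Fin n →₀ ℕ} (hα : ∑ i, α i = m) (y : Fin n → 𝕜) :
    ∑ j ∈ Fintype.piFinset fun i => Finset.range (α i + 1),
      (∏ i, ((-1 : 𝕜) ^ (α i - j i) * (α i).choose (j i))) *
        MvPolynomial.eval (fun i => y i + j i) P = P.coeff α * ∏ i, ((α i).factorial : 𝕜) := by
  have key (d : Fin n →₀ ℕ) :
      ∑ j ∈ Fintype.piFinset fun i => Finset.range (α i + 1),
        (∏ i, ((-1 : 𝕜) ^ (α i - j i) * (α i).choose (j i))) * ∏ i, (y i + j i) ^ d i =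
      ∏ i, ∑ k ∈ Finset.range (α i + 1),
        ((-1 : 𝕜) ^ (α i - k) * (α i).choose k) * (y i + k) ^ d i := by
    rw [Finset.prod_univ_sum]
    exact Finset.sum_congr rfl fun j _ => Finset.prod_mul_distrib.symm
  calc _ = ∑ d ∈ P.support, P.coeff d *
        ∏ i, ∑ k ∈ Finset.range (α i + 1),
          ((-1 : 𝕜) ^ (α i - k) * (α i).choose k) * (y i + k) ^ d i := by
        simp only [← key, MvPolynomial.eval_eq', Finset.mul_sum]
        rw [Finset.sum_comm]
        exact Finset.sum_congr rfl fun d _ => Finset.sum_congr rfl fun j _ => mul_left_comm _ _ _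
    _ = P.coeff α * ∏ i, ∑ k ∈ Finset.range (α i + 1),
          ((-1 : 𝕜) ^ (α i - k) * (α i).choose k) * (y i + k) ^ α i := by
        refine Finset.sum_eq_single α (fun d hd hne => ?_) fun h => ?_
        · have hsum : ∑ i, d i = ∑ i, α i := by
            rw [hα, sum_eq_of_coeff_ne_zero hP (MvPolynomial.mem_support_iff.1 hd)]
          obtain ⟨i, hi⟩ : ∃ i, d i < α i := by
            by_contra! h
            have := (Finset.sum_eq_sum_iff_of_le fun i _ => h i).1 hsum.symm
            exact hne (Finsupp.ext fun i => (this i (Finset.mem_univ i)).symm)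
          rw [Finset.prod_eq_zero (Finset.mem_univ i) (sum_choose_mul_pow_of_lt hi _), mul_zero]
        · rw [MvPolynomial.notMem_support_iff.1 h, zero_mul]
    _ = _ := by simp only [sum_choose_mul_pow_self]

theorem sum_norm_choose (α : Fin n →₀ ℕ) (hα : ∑ i, α i = m) :
    ∑ j ∈ Fintype.piFinset fun i => Finset.range (α i + 1),
      ‖∏ i, ((-1 : 𝕜) ^ (α i - j i) * (α i).choose (j i))‖ = 2 ^ m := by
  simp only [norm_prod, norm_mul, norm_pow, norm_neg, norm_one, one_pow, one_mul,
    RCLike.norm_natCast]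
  rw [← Finset.prod_univ_sum (fun i => Finset.range (α i + 1))
    (fun i k => ((α i).choose k : ℝ)), ← hα, ← Finset.prod_pow_eq_pow_sum]
  refine Finset.prod_congr rfl fun i _ => ?_
  exact_mod_cast Nat.sum_range_choose (α i)

theorem norm_neg_half_add_le {a k : ℕ} (hk : k ≤ a) : ‖-((a : 𝕜) / 2) + k‖ ≤ (a : ℝ) / 2 := by
  have h : -((a : 𝕜) / 2) + k = ((-((a : ℝ) / 2) + k : ℝ) : 𝕜) := by push_cast; rfl
  rw [h, RCLike.norm_ofReal, abs_le]
  have hk' : (k : ℝ) ≤ a := by exact_mod_cast hk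
  have : (0 : ℝ) ≤ k := k.cast_nonneg
  constructor <;> linarith

/-- The coefficients of an `m`-homogeneous polynomial on `ℓ_m^n` are bounded by `m ^ m` times
its norm. -/
theorem norm_coeff_le (hm : 1 ≤ m) {P : MvPolynomial (Fin n) 𝕜} (hP : P.IsHomogeneous m)
    {α : Fin n →₀ ℕ} (hα : ∑ i, α i = m) :
    ‖P.coeff α‖ ≤ (m : ℝ) ^ m * polyNorm (m : ℝ≥0∞) P := by
  have hm0 : (0 : ℝ) < m := by exact_mod_cast hm
  have heval : ∀ j ∈ Fintype.piFinset fun i => Finset.range (α i + 1),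
      ‖MvPolynomial.eval (fun i => -((α i : 𝕜) / 2) + j i) P‖ ≤
        ((m : ℝ) / 2) ^ m * polyNorm (m : ℝ≥0∞) P := by
    intro j hj
    refine norm_eval_le_mul_polyNorm hm hP (by positivity) _ ?_
    -- The base point `-α/2` puts each node coordinate in `[-α i/2, α i/2]`. Keeping one factor `α
    -- i/2` and bounding the others by `m/2` lets `∑ α i = m` close the estimate.
    calc ∑ i, ‖-((α i : 𝕜) / 2) + j i‖ ^ m
        ≤ ∑ i, (α i / 2 : ℝ) * ((m : ℝ) / 2) ^ (m - 1) := by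
          refine Finset.sum_le_sum fun i _ => ?_
          have hji : j i ≤ α i := Nat.lt_succ_iff.1 <|
            Finset.mem_range.1 (Fintype.mem_piFinset.1 hj i)
          have hαi : (α i : ℝ) ≤ m := by
            exact_mod_cast hα ▸ Finset.single_le_sum (f := fun i => α i)
              (fun _ _ => Nat.zero_le _) (Finset.mem_univ i)
          calc ‖-((α i : 𝕜) / 2) + j i‖ ^ m ≤ ((α i : ℝ) / 2) ^ m :=
                pow_le_pow_left₀ (norm_nonneg _) (norm_neg_half_add_le hji) m
            _ = (α i / 2 : ℝ) * ((α i : ℝ) / 2) ^ (m - 1) := (mul_pow_sub_one (by omega) _).symm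
            _ ≤ _ := by gcongr
      _ = ((m : ℝ) / 2) ^ m := by
          rw [← Finset.sum_mul, ← Finset.sum_div, ← Nat.cast_sum, hα,
            mul_pow_sub_one (by omega)]
  have hfact : (1 : ℝ) ≤ ‖∏ i, ((α i).factorial : 𝕜)‖ := by
    rw [← Nat.cast_prod, RCLike.norm_natCast]
    exact_mod_cast Finset.prod_pos fun i _ => Nat.factorial_pos (α i)
  calc ‖P.coeff α‖ ≤ ‖P.coeff α‖ * ‖∏ i, ((α i).factorial : 𝕜)‖ :=
        le_mul_of_one_le_right (norm_nonneg _) hfact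
    _ ≤ ∑ j ∈ Fintype.piFinset fun i => Finset.range (α i + 1),
        ‖∏ i, ((-1 : 𝕜) ^ (α i - j i) * (α i).choose (j i))‖ *
          (((m : ℝ) / 2) ^ m * polyNorm (m : ℝ≥0∞) P) := by
        rw [← norm_mul, ← sum_choose_mul_eval_eq hP hα fun i => -((α i : 𝕜) / 2)]
        refine (norm_sum_le _ _).trans (Finset.sum_le_sum fun j hj => ?_)
        rw [norm_mul]
        exact mul_le_mul_of_nonneg_left (heval j hj) (norm_nonneg _)
    _ = (m : ℝ) ^ m * polyNorm (m : ℝ≥0∞) P := by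
        rw [← Finset.sum_mul, sum_norm_choose α hα, ← mul_assoc, ← mul_pow,
          mul_div_cancel₀ _ two_ne_zero]

theorem norm_coeff_le_coeffMax (P : MvPolynomial (Fin n) 𝕜) {α : Fin n →₀ ℕ}
    (hα : ∑ i, α i = m) : ‖P.coeff α‖ ≤ coeffMax m P := by
  have h := Finset.le_sup (f := fun α => ‖P.coeff α‖₊) (mem_multiIndices.2 hα)
  exact_mod_cast h

theorem coeffMax_le (P : MvPolynomial (Fin n) 𝕜) {B : ℝ} (hB : 0 ≤ B)
    (h : ∀ α : Fin n →₀ ℕ, ∑ i, α i = m → ‖P.coeff α‖ ≤ B) : coeffMax m P ≤ B := by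
  lift B to ℝ≥0 using hB
  exact NNReal.coe_le_coe.2 (Finset.sup_le fun α hα => h α (mem_multiIndices.1 hα))

end Coefficients

/-! ### The extremal example `∑ x_i^m`. -/

section PowerSum

theorem psum_isHomogeneous (𝕜 : Type*) [RCLike 𝕜] (n m : ℕ) :
    (MvPolynomial.psum (Fin n) 𝕜 m).IsHomogeneous m := by
  refine MvPolynomial.IsHomogeneous.sum _ _ _ fun i _ => ?_
  simpa using (MvPolynomial.isHomogeneous_X 𝕜 i).pow m

theorem polyNorm_psum_le (𝕜 : Type*) [RCLike 𝕜] (n : ℕ) {m : ℕ} (hm : 1 ≤ m) :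
    polyNorm (m : ℝ≥0∞) (MvPolynomial.psum (Fin n) 𝕜 m) ≤ 1 := by
  refine polyNorm_le hm _ fun y hy => ?_
  simp only [MvPolynomial.psum, map_sum, map_pow, MvPolynomial.eval_X]
  exact (norm_sum_le _ _).trans (by simpa only [norm_pow] using hy)

theorem coeff_psum_single (𝕜 : Type*) [RCLike 𝕜] {n m : ℕ} (hm : 1 ≤ m) (i : Fin n) :
    (MvPolynomial.psum (Fin n) 𝕜 m).coeff (Finsupp.single i m) = 1 := by
  classical
  simp only [MvPolynomial.psum, MvPolynomial.coeff_sum, MvPolynomial.coeff_X_pow]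
  rw [Finset.sum_eq_single i]
  · simp
  · intro j _ hj
    rw [if_neg]
    intro h
    exact hj ((Finsupp.single_left_inj (by omega)).1 h)
  · simp

theorem rpow_le_coeffLr_psum (𝕜 : Type*) [RCLike 𝕜] (n : ℕ) {m : ℕ} (hm : 1 ≤ m) {r : ℝ}
    (hr : 0 < r) : (n : ℝ) ^ (1 / r) ≤ coeffLr m r (MvPolynomial.psum (Fin n) 𝕜 m) := by
  classical
  refine Real.rpow_le_rpow (by positivity) ?_ (by positivity)
  have hinj : Function.Injective fun i : Fin n => Finsupp.single i m :=
    Finsupp.single_left_injective (by omega)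
  calc (n : ℝ) = ∑ i : Fin n,
        ‖(MvPolynomial.psum (Fin n) 𝕜 m).coeff (Finsupp.single i m)‖ ^ r := by
        simp [coeff_psum_single 𝕜 hm]
    _ = ∑ α ∈ Finset.univ.image fun i : Fin n => Finsupp.single i m,
        ‖(MvPolynomial.psum (Fin n) 𝕜 m).coeff α‖ ^ r :=
        (Finset.sum_image (f := fun α => ‖(MvPolynomial.psum (Fin n) 𝕜 m).coeff α‖ ^ r)
          fun _ _ _ _ h => hinj h).symm
    _ ≤ _ := by
        refine Finset.sum_le_sum_of_subset_of_nonneg ?_ fun _ _ _ => by positivity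
        intro α hα
        obtain ⟨i, -, rfl⟩ := Finset.mem_image.1 hα
        simp [mem_multiIndices, Finsupp.single_apply]

end PowerSum

/-! ### Admissible constants. -/

section Constants

theorem pow_mem_supConstants (𝕜 : Type*) [RCLike 𝕜] {m : ℕ} (hm : 1 ≤ m) :
    (m : ℝ) ^ m ∈ supConstants 𝕜 m := fun _ _ P hP =>
  coeffMax_le P (mul_nonneg (by positivity) (polyNorm_nonneg _ P)) fun _ hα =>
    norm_coeff_le hm hP hα

theorem one_le_of_mem_supConstants {𝕜 : Type*} [RCLike 𝕜] {m : ℕ} (hm : 1 ≤ m) {C : ℝ}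
    (hC : C ∈ supConstants 𝕜 m) : 1 ≤ C := by
  have h := hC 1 le_rfl _ (psum_isHomogeneous 𝕜 1 m)
  have h1 := norm_coeff_le_coeffMax (m := m) (MvPolynomial.psum (Fin 1) 𝕜 m)
    (α := Finsupp.single 0 m) (by simp)
  rw [coeff_psum_single 𝕜 hm, norm_one] at h1
  have h2 := polyNorm_psum_le 𝕜 1 hm
  have h3 := polyNorm_nonneg (m : ℝ≥0∞) (MvPolynomial.psum (Fin 1) 𝕜 m)
  have h4 := h1.trans h
  -- Only `1 ≤ C * ‖P‖` and `0 ≤ ‖P‖ ≤ 1` are known, so `‖P‖ = 0` is excluded separately.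
  by_contra! hlt
  rcases h3.eq_or_lt with h0 | h0
  · rw [← h0, mul_zero] at h4
    linarith
  · linarith [mul_lt_mul_of_pos_right hlt h0]

/-- Each `P` imposes a closed condition on `C`; closedness is what makes the infimum an attained
minimum. -/
theorem isClosed_supConstants (𝕜 : Type*) [RCLike 𝕜] (m : ℕ) :
    IsClosed (supConstants 𝕜 m) := by
  simp only [supConstants, Set.ofPred_forall]
  exact isClosed_iInter fun n => isClosed_iInter fun _ => isClosed_iInter fun P =>
    isClosed_iInter fun _ => isClosed_le continuous_const (by fun_prop)

theorem exists_isLeast_supConstants (𝕜 : Type*) [RCLike 𝕜] {m : ℕ} (hm : 1 ≤ m) :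
    ∃ C : ℝ, IsLeast (supConstants 𝕜 m) C ∧ 1 ≤ C ∧ C ≤ (m : ℝ) ^ m := by
  have h := (isClosed_supConstants 𝕜 m).isLeast_csInf ⟨_, pow_mem_supConstants 𝕜 hm⟩
    ⟨1, fun _ hC => one_le_of_mem_supConstants hm hC⟩
  exact ⟨_, h, one_le_of_mem_supConstants hm h.1, h.2 (pow_mem_supConstants 𝕜 hm)⟩

theorem notMem_lrConstants (𝕜 : Type*) [RCLike 𝕜] {m : ℕ} (hm : 1 ≤ m) {r : ℝ} (hr : 0 < r)
    (C : ℝ) : C ∉ lrConstants 𝕜 m r := by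
  intro hC
  -- The power sum in `n` variables would force `n ^ (1 / r) ≤ |C|`.
  obtain ⟨n, hn⟩ := exists_nat_gt (max 1 (|C| ^ r))
  have hn1 : 1 ≤ n := by
    have : (1 : ℝ) < n := (le_max_left _ _).trans_lt hn
    exact_mod_cast this.le
  have h1 : (n : ℝ) ^ (1 / r) ≤ |C| := by
    refine (rpow_le_coeffLr_psum 𝕜 n hm hr).trans
      ((hC n hn1 _ (psum_isHomogeneous 𝕜 n m)).trans ?_)
    have h0 := polyNorm_nonneg (m : ℝ≥0∞) (MvPolynomial.psum (Fin n) 𝕜 m)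
    exact (mul_le_mul_of_nonneg_right (le_abs_self C) h0).trans
      (mul_le_of_le_one_right (abs_nonneg C) (polyNorm_psum_le 𝕜 n hm))
  have h2 : (n : ℝ) ≤ |C| ^ r := by
    have := Real.rpow_le_rpow (by positivity) h1 hr.le
    rwa [← Real.rpow_mul (by positivity), one_div_mul_cancel hr.ne', Real.rpow_one] at this
  exact absurd ((le_max_right _ _).trans_lt hn) h2.not_gt

end Constants

end HardyLittlewood

theorem mainTheorem1 (m : ℕ) (hm : 2 ≤ m) :
    (∃ C : ℝ, IsLeast (HardyLittlewood.supConstants ℝ m) C ∧ 1 ≤ C ∧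
      C ≤ Real.sqrt 2 ^ (m - 1) * (m : ℝ) ^ m) ∧
    (∃ C : ℝ, IsLeast (HardyLittlewood.supConstants ℂ m) C ∧ 1 ≤ C ∧
      C ≤ (2 / Real.sqrt Real.pi) ^ (m - 1) * (m : ℝ) ^ m) ∧
    (∀ r : ℝ, 0 < r →
      ¬ (∃ C : ℝ, C ∈ HardyLittlewood.lrConstants ℝ m r) ∧
      ¬ (∃ C : ℝ, C ∈ HardyLittlewood.lrConstants ℂ m r)) := by
  have hm1 : 1 ≤ m := by omega
  -- The factors `√2` and `2/√π` are at least 1 (the latter as `π ≤ 4`), so `m^m` suffices for both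
  -- fields.
  have hle {c : ℝ} (hc : 1 ≤ c) : (m : ℝ) ^ m ≤ c ^ (m - 1) * (m : ℝ) ^ m :=
    le_mul_of_one_le_left (by positivity) (one_le_pow₀ hc)
  refine ⟨?_, ?_, fun r hr => ⟨fun ⟨C, hC⟩ => ?_, fun ⟨C, hC⟩ => ?_⟩⟩
  · obtain ⟨C, hC, h1, h2⟩ := HardyLittlewood.exists_isLeast_supConstants ℝ hm1
    exact ⟨C, hC, h1, h2.trans (hle (Real.one_le_sqrt.2 one_le_two))⟩
  · obtain ⟨C, hC, h1, h2⟩ := HardyLittlewood.exists_isLeast_supConstants ℂ hm1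
    refine ⟨C, hC, h1, h2.trans (hle ?_)⟩
    rw [one_le_div (Real.sqrt_pos.2 Real.pi_pos), Real.sqrt_le_left zero_le_two]
    linarith [Real.pi_le_four]
  · exact HardyLittlewood.notMem_lrConstants ℝ hm1 hr C hC
  · exact HardyLittlewood.notMem_lrConstants ℂ hm1 hr C hC
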